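/- Let $\mathcal R$ be the cone of infinite distance matrices, i.e. of real matrices $r=(r_{i,j})_{i,j\ge 1}$ with $r_{i,i}=0$, $r_{i,j}=r_{j,i}\ge 0$ and $r_{i,j}\le r_{i,k}+r_{k,j}$ for all $i,j,k$; $r$ is called proper if $r_{i,j}\ne 0$ for $i\ne j$. For a distance matrix $q$ of order $n$ let $A(q)=\{a\in\mathbb R^n : |a_i-a_j|\le q_{i,j}\le a_i+a_j \text{ for all } i,j\}$. A matrix $r\in\mathcal R$ is called universal if for every $\varepsilon>0$, every $n$ and every $a\in A\big((r_{i,j})_{i,j\le n}\big)$ there is an $m$ with $\max_{i\le n}|r_{i,m}-a_i|<\varepsilon$. Let $\gamma$ be an atomless (continuous) Borel probability measure on $[0,\infty)$ whose support is all of $[0,\infty)$. Let $\nu_\gamma$ be the law of the random matrix $r\in\mathcal R$ whose entries above the diagonal are chosen one after another in the order $r_{1,2},\ r_{1,3},\ r_{2,3},\ r_{1,4},\ r_{2,4},\ r_{3,4},\dots$ so that each $r_{1,n}$, $n\ge 2$, has distribution $\gamma$ and is independent of the entries chosen before it, and, for $1\le k<n-1$, the conditional distribution of $r_{k+1,n}$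 given the entries chosen before it is the normalized Lebesgue measure on the segment $\big[\max_{i\le k}|r_{i,k+1}-r_{i,n}|,\ \min_{i\le k}(r_{i,k+1}+r_{i,n})\big]$ of the values allowed by the triangle inequality (the unit mass at the point if the segment is a point). Then $\nu_\gamma$ is a probability measure on $\mathcal R$, and $\nu_\gamma$-almost every matrix $r$ is proper and universal. Consequently, for $\nu_\gamma$-almost every $r$ the completion of the set of positive integers with respect to the metric $r$ is isometric to the Urysohn space: it is a complete separable metric space which contains an isometric copy of every complete separable metric space and in which every isometry between two finite subsets extends to an isometry of the whole space onto itself, and it is isometric to every other metric space with these properties. -/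

import Mathlib

open MeasureTheory ProbabilityTheory Set
open scoped NNReal ENNReal

noncomputable section

namespace RandomMetric

/-! ### Distance matrices

The positive integers `1, 2, 3, …` are represented by the natural numbers `0, 1, 2, …`. -/

/-- The cone of infinite distance matrices (zeros off the diagonal are allowed). -/
def distCone : Set (ℕ → ℕ → ℝ) :=
  {r | (∀ i, r i i = 0) ∧ (∀ i j, 0 ≤ r i j) ∧ (∀ i j, r i j = r j i) ∧
    ∀ i j k, r i j ≤ r i k + r k j}

/-- A distance matrix is proper if it has no zeros outside the main diagonal. -/
def IsProper (r : distCone) : Prop := ∀ i j, i ≠ j → r.1 i j ≠ 0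

/-- The north-west corner of order `n`. -/
def corner (n : ℕ) (r : ℕ → ℕ → ℝ) : Fin n → Fin n → ℝ := fun i j => r i j

/-- The set `A(q)` of admissible vectors of a distance matrix `q` of order `n`. -/
def admissible {n : ℕ} (q : Fin n → Fin n → ℝ) : Set (Fin n → ℝ) :=
  {a | ∀ i j, |a i - a j| ≤ q i j ∧ q i j ≤ a i + a j}

/-- Universal distance matrices. -/
def IsUniversal (r : distCone) : Prop :=
  ∀ ε : ℝ, 0 < ε → ∀ n : ℕ, ∀ a ∈ admissible (corner n r.1),
    ∃ m : ℕ, ∀ i : Fin n, |r.1 i m - a i| < ε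

/-! ### The (semi)metric on the integers given by a distance matrix -/

/-- The set of positive integers, to be equipped with the semimetric given by `r`. -/
def Points (_r : distCone) : Type := ℕ

instance (r : distCone) : PseudoMetricSpace (Points r) where
  dist := fun i j : ℕ => r.1 i j
  dist_self := r.2.1
  dist_comm := r.2.2.2.1
  dist_triangle := fun i j k => r.2.2.2.2 i k j

/-- The completion of the integers in the (semi)metric `r`, a metric space; points at distance
zero are identified. -/
abbrev Completed (r : distCone) : Type := UniformSpace.Completion (Points r)

/-! ### The Urysohn space -/

/-- `U` is the Urysohn space: a Polish (complete separable metric) space which is universal, i.e.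
contains an isometric copy of every Polish space, and homogeneous, i.e. every isometry between
finite subsets is induced by an isometry of `U` onto itself. Every Polish space is isometric to
one whose underlying type is in `Type`, so it is enough to consider these. -/
structure IsUrysohn (U : Type*) [MetricSpace U] : Prop where
  complete : CompleteSpace U
  separable : TopologicalSpace.SeparableSpace U
  universal : ∀ (X : Type) [MetricSpace X] [CompleteSpace X] [TopologicalSpace.SeparableSpace X],
    ∃ f : X → U, Isometry f
  homogeneous : ∀ (m : ℕ) (a b : Fin m → U), (∀ i j, dist (a i) (a j) = dist (b i) (b j)) →
    ∃ J : U ≃ᵢ U, ∀ i, J (a i) = b i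

/-! ### The measure of the random distance matrix -/

/-- The Lebesgue measure on the segment `[a, b]` normalized to one; the unit mass at `a` if the
segment degenerates to a point. (The value for `b < a` is irrelevant.) -/
def unif (a b : ℝ) : Measure ℝ :=
  if a < b then (volume (Icc a b))⁻¹ • volume.restrict (Icc a b) else Measure.dirac a

theorem measurable_unif : Measurable fun p : ℝ × ℝ => unif p.1 p.2 := by
  unfold unif
  refine Measurable.ite (measurableSet_lt measurable_fst measurable_snd) ?_
    (Measure.measurable_dirac.comp measurable_fst)
  refine Measure.measurable_of_measurable_coe _ fun s hs => ?_
  simp only [Measure.smul_apply, smul_eq_mul, Measure.restrict_apply hs, Real.volume_Icc]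
  refine Measurable.mul (by fun_prop) ?_
  have hS : MeasurableSet {q : (ℝ × ℝ) × ℝ | q.2 ∈ s ∧ q.1.1 ≤ q.2 ∧ q.2 ≤ q.1.2} :=
    (measurable_snd hs).inter
      ((measurableSet_le (measurable_fst.comp measurable_fst) measurable_snd).inter
        (measurableSet_le measurable_snd (measurable_snd.comp measurable_fst)))
  exact measurable_measure_prodMk_left (ν := (volume : Measure ℝ)) hS

/-- `unif` as a Markov kernel from pairs of endpoints. -/
def unifKernel : Kernel (ℝ × ℝ) ℝ := ⟨fun p => unif p.1 p.2, measurable_unif⟩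

instance : IsMarkovKernel unifKernel := by
  refine ⟨fun p => ⟨?_⟩⟩
  change unif p.1 p.2 univ = 1
  unfold unif
  split_ifs with h
  · have h0 : ENNReal.ofReal (p.2 - p.1) ≠ 0 := by simpa using h
    simp [Real.volume_Icc, ENNReal.inv_mul_cancel h0 ENNReal.ofReal_ne_top]
  · simp

/-- The least value of `r (k+1) n` that the triangle inequality allows, given the entries `r i j`
with `i, j < n` and `r i n` with `i ≤ k`. -/
def lower (k n : ℕ) (r : ℕ → ℕ → ℝ) : ℝ :=
  (Finset.range (k + 1)).sup' Finset.nonempty_range_add_one fun i => |r i (k + 1) - r i n|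

/-- The greatest such value. -/
def upper (k n : ℕ) (r : ℕ → ℕ → ℝ) : ℝ :=
  (Finset.range (k + 1)).inf' Finset.nonempty_range_add_one fun i => r i (k + 1) + r i n

theorem measurable_bounds (k n : ℕ) :
    Measurable fun r : ℕ → ℕ → ℝ => (lower k n r, upper k n r) := by
  have hl : Measurable (lower k n) := by
    unfold lower
    exact Finset.measurable_range_sup'' fun i _ => by fun_prop
  have hu : Measurable (upper k n) := by
    have : upper k n = (Finset.range (k + 1)).inf' Finset.nonempty_range_add_one
        fun i (r : ℕ → ℕ → ℝ) => r i (k + 1) + r i n := by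
      ext r; simp [upper, Finset.inf'_apply]
    rw [this]
    exact Finset.inf'_induction _ _ (fun f hf g hg => hf.inf hg) fun i _ => by fun_prop
  exact hl.prodMk hu

/-- The conditional distribution of the entry `r i j`, `i < j`, given the entries of `r` that
precede it: in the first row it is `γ`, independently of these entries, and in the other rows it
is uniform on the segment of all the values allowed by the triangle inequality. -/
def entryKernel (γ : Measure ℝ≥0) : ℕ → ℕ → Kernel (ℕ → ℕ → ℝ) ℝ
  | 0, _ => Kernel.const _ (γ.map ((↑) : ℝ≥0 → ℝ))
  | k + 1, j => unifKernel.comap (fun r => (lower k j r, upper k j r)) (measurable_bounds k j)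

/-- The entries above the diagonal in the order in which they are chosen, column by column:
`(0,1), (0,2), (1,2), (0,3), (1,3), (2,3), …`. -/
def entryAt : ℕ → ℕ × ℕ
  | 0 => (0, 1)
  | t + 1 => if (entryAt t).1 + 1 < (entryAt t).2 then ((entryAt t).1 + 1, (entryAt t).2)
      else (0, (entryAt t).2 + 1)

/-- The position of the entry `(i, j)`, `i < j`, in this order. -/
def entryIndex (i j : ℕ) : ℕ := j.choose 2 + i

/-- The symmetric matrix with zero diagonal with the given sequence of entries. -/
def toMatrix (x : ℕ → ℝ) : ℕ → ℕ → ℝ := fun i j =>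
  if i < j then x (entryIndex i j) else if j < i then x (entryIndex j i) else 0

/-- The matrix fragment given by the entries chosen up to time `t`; the entries not yet chosen are
set to zero, and they are never used. -/
def fragment (t : ℕ) (x : (s : Finset.Iic t) → ℝ) : ℕ → ℕ → ℝ :=
  toMatrix fun s => if h : s ∈ Finset.Iic t then x ⟨s, h⟩ else 0

theorem measurable_toMatrix : Measurable toMatrix := by
  refine measurable_pi_lambda _ fun i => measurable_pi_lambda _ fun j => ?_
  unfold toMatrix
  split_ifs <;> fun_prop

theorem measurable_fragment (t : ℕ) : Measurable (fragment t) := by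
  refine measurable_toMatrix.comp (measurable_pi_lambda _ fun s => ?_)
  split_ifs <;> fun_prop

/-- The conditional distribution of the entry chosen at time `t + 1`, given those chosen up to
time `t`. -/
def stepKernel (γ : Measure ℝ≥0) (t : ℕ) : Kernel ((s : Finset.Iic t) → ℝ) ℝ :=
  (entryKernel γ (entryAt (t + 1)).1 (entryAt (t + 1)).2).comap (fragment t)
    (measurable_fragment t)

instance (γ : Measure ℝ≥0) [IsProbabilityMeasure γ] (i j : ℕ) :
    IsMarkovKernel (entryKernel γ i j) := by
  have : IsProbabilityMeasure (γ.map ((↑) : ℝ≥0 → ℝ)) :=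
    Measure.isProbabilityMeasure_map (by fun_prop)
  cases i <;> (unfold entryKernel; infer_instance)

instance (γ : Measure ℝ≥0) [IsProbabilityMeasure γ] (t : ℕ) :
    IsMarkovKernel (stepKernel γ t) := by
  unfold stepKernel; infer_instance

/-- The law of the sequence of entries: the first one has distribution `γ`, and each of the
following ones is chosen according to `stepKernel`. -/
def entryLaw (γ : Measure ℝ≥0) [IsProbabilityMeasure γ] : Measure (ℕ → ℝ) :=
  Kernel.trajMeasure (X := fun _ => ℝ) (γ.map ((↑) : ℝ≥0 → ℝ)) (stepKernel γ)

/-- The measure `ν_γ` on the cone of distance matrices: the law of the random matrix with these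
entries, regarded as a measure on the cone. -/
def nu (γ : Measure ℝ≥0) [IsProbabilityMeasure γ] : Measure distCone :=
  ((entryLaw γ).map toMatrix).comap Subtype.val

end RandomMetric

end

/-!
A one-point extension of a finite subset of the completion of a universal matrix is realized up to
any error; completeness turns these approximate realizations into exact ones by a rapidly
converging sequence. Realizing one-point extensions alternately on both sides (back and forth along
dense sequences) gives all the embeddings and isometries that characterize the Urysohn space.

For a random matrix, fix a vector which is admissible for the first `n` points. Conditionally on all
the preceding columns, the next column is close to this vector in its first `n` entries with
probability at least some `p > 0` which does not depend on the past: `γ` charges every interval, and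
each further entry is uniform on a segment of bounded length which comes close to the prescribed
value. So almost surely some column succeeds, and countably many vectors and errors suffice. The
matrix is proper since the entries of its first row, chosen from an atomless distribution, are
pairwise distinct.
-/

noncomputable section

namespace RandomMetric

open Filter Topology

/-! ### Katětov functions -/

/-- Katětov functions: the vectors `a` that extend the distance matrix `q` by one point, `a i` being
the distance to the new point. With `q = dist` these are the Katětov functions of a metric space,
and over `Fin n` they form the set `admissible q`. -/
def IsKatetov {ι : Type*} (q : ι → ι → ℝ) (a : ι → ℝ) : Prop :=
  ∀ i j, |a i - a j| ≤ q i j ∧ q i j ≤ a i + a j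

namespace IsKatetov

variable {ι : Type*} {q : ι → ι → ℝ} {a b : ι → ℝ}

theorem sub_le (ha : IsKatetov q a) (i j : ι) : a i - a j ≤ q i j :=
  (le_abs_self _).trans (ha i j).1

theorem le_add (ha : IsKatetov q a) (i j : ι) : q i j ≤ a i + a j :=
  (ha i j).2

theorem nonneg (ha : IsKatetov q a) (i : ι) : 0 ≤ a i := by
  linarith [ha.sub_le i i, ha.le_add i i]

theorem abs_sub_le_add (ha : IsKatetov q a) (hb : IsKatetov q b) (i j : ι) :
    |a i - b i| ≤ a j + b j := by
  rw [abs_sub_le_iff]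
  constructor <;> linarith [ha.sub_le i j, ha.le_add i j, hb.sub_le i j, hb.le_add i j]

theorem comp {κ : Type*} (ha : IsKatetov q a) (e : κ → ι) :
    IsKatetov (fun i j => q (e i) (e j)) (a ∘ e) :=
  fun i j => ha (e i) (e j)

end IsKatetov

section PseudoMetric

variable {X : Type*} [PseudoMetricSpace X]

theorem isKatetov_dist_left (x : X) : IsKatetov dist fun y => dist y x :=
  fun _ _ => ⟨abs_dist_sub_le _ _ _, dist_triangle_right _ _ _⟩

/-- The extension of `X` by one point, `none`, whose distances are given by a Katětov function. -/
abbrev IsKatetov.pseudoMetricSpaceOption {f : X → ℝ} (hf : IsKatetov dist f) :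
    PseudoMetricSpace (Option X) where
  dist
    | none, none => 0
    | none, some x => f x
    | some x, none => f x
    | some x, some y => dist x y
  dist_self := by rintro (_ | x) <;> simp
  dist_comm := by rintro (_ | x) (_ | y) <;> simp [dist_comm]
  dist_triangle := by
    rintro (_ | x) (_ | y) (_ | z)
    · simp
    · simp
    · simpa using hf.nonneg y
    · simp only
      linarith [hf.sub_le z y, dist_comm z y]
    · simp
    · exact hf.le_add x z
    · simp only
      linarith [hf.sub_le x y]
    · exact dist_triangle _ _ _

theorem IsKatetov.exists_extension {ι : Type*} [Finite ι] [Nonempty ι] {x : ι → X} {a : ι → ℝ}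
    (ha : IsKatetov (fun i j => dist (x i) (x j)) a) :
    ∃ f : X → ℝ, IsKatetov dist f ∧ ∀ i, f (x i) = a i := by
  -- The largest extension, `f y = min i, a i + dist (x i) y`.
  choose g hg using fun y => Finite.exists_min fun i => a i + dist (x i) y
  have sub_le : ∀ y z, a (g y) + dist (x (g y)) y - (a (g z) + dist (x (g z)) z) ≤ dist y z :=
    fun y z => by linarith [hg y (g z), dist_triangle_right (x (g z)) y z]
  refine ⟨fun y => a (g y) + dist (x (g y)) y, fun y z => ⟨?_, ?_⟩, fun i => le_antisymm ?_ ?_⟩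
  · exact abs_sub_le_iff.2 ⟨sub_le y z, dist_comm y z ▸ sub_le z y⟩
  · linarith [ha.le_add (g y) (g z), dist_triangle4 y (x (g y)) (x (g z)) z,
      dist_comm (x (g y)) y]
  · simpa using hg (x i) i
  · linarith [ha.sub_le i (g (x i)), dist_comm (x i) (x (g (x i)))]

end PseudoMetric

/-! ### Isometric relations -/

/-- A relation between two spaces which preserves distances, i.e. the graph of a partial isometry
up to points at distance zero. -/
def IsometricRel {X Y : Type*} [PseudoMetricSpace X] [PseudoMetricSpace Y] (G : Set (X × Y)) :
    Prop :=
  ∀ p ∈ G, ∀ q ∈ G, dist p.1 q.1 = dist p.2 q.2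

namespace IsometricRel

section PseudoMetric

variable {X Y : Type*} [PseudoMetricSpace X] [PseudoMetricSpace Y] {G : Set (X × Y)}

theorem empty : IsometricRel (∅ : Set (X × Y)) :=
  fun _ hp => hp.elim

theorem swap (hG : IsometricRel G) : IsometricRel (Prod.swap ⁻¹' G) :=
  fun _ hp _ hq => (hG _ hp _ hq).symm

theorem insert (hG : IsometricRel G) {x : X} {y : Y} (h : ∀ p ∈ G, dist p.1 x = dist p.2 y) :
    IsometricRel (insert (x, y) G) := by
  rintro p (rfl | hp) q (rfl | hq)
  · simp
  · simpa only [dist_comm] using h q hq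
  · exact h p hp
  · exact hG p hp q hq

theorem iUnion_of_directed {ι : Type*} {F : ι → Set (X × Y)} (hF : Directed (· ⊆ ·) F)
    (h : ∀ i, IsometricRel (F i)) : IsometricRel (⋃ i, F i) := by
  intro p hp q hq
  obtain ⟨i, hi⟩ := mem_iUnion.1 hp
  obtain ⟨j, hj⟩ := mem_iUnion.1 hq
  obtain ⟨k, hik, hjk⟩ := hF i j
  exact h k p (hik hi) q (hjk hj)

theorem closure (hG : IsometricRel G) : IsometricRel (closure G) := by
  have hclosed : IsClosed {z : (X × Y) × (X × Y) | dist z.1.1 z.2.1 = dist z.1.2 z.2.2} :=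
    isClosed_eq (by fun_prop) (by fun_prop)
  intro p hp q hq
  refine closure_minimal (s := G ×ˢ G) (fun z hz => hG _ hz.1 _ hz.2) hclosed (a := (p, q)) ?_
  rw [closure_prod_eq]
  exact ⟨hp, hq⟩

theorem exists_mem_closure [CompleteSpace Y] (hG : IsometricRel G) (hd : Dense (Prod.fst '' G))
    (x : X) : ∃ y, (x, y) ∈ _root_.closure G := by
  obtain ⟨s, hs, hx⟩ := mem_closure_iff_seq_limit.1 (hd x)
  choose g hg hgs using hs
  obtain rfl : (fun n => (g n).1) = s := funext hgs
  have hcauchy : CauchySeq fun n => (g n).2 := by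
    have h := hx.cauchySeq
    simpa only [Metric.cauchySeq_iff, hG _ (hg _) _ (hg _)] using h
  obtain ⟨y, hy⟩ := cauchySeq_tendsto_of_complete hcauchy
  exact ⟨y, mem_closure_of_tendsto (hx.prodMk_nhds hy) (Eventually.of_forall hg)⟩

theorem exists_isometry [CompleteSpace Y] (hG : IsometricRel G) (hd : Dense (Prod.fst '' G)) :
    ∃ f : X → Y, Isometry f := by
  choose f hf using hG.exists_mem_closure hd
  exact ⟨f, Isometry.of_dist_eq fun x x' => (hG.closure _ (hf x) _ (hf x')).symm⟩

end PseudoMetric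

variable {X Y : Type*} [MetricSpace X] [MetricSpace Y] {G : Set (X × Y)}

theorem snd_eq {X : Type*} [PseudoMetricSpace X] {G : Set (X × Y)} (hG : IsometricRel G) {x : X}
    {y y' : Y} (h : (x, y) ∈ G) (h' : (x, y') ∈ G) : y = y' :=
  dist_eq_zero.1 ((hG _ h _ h').symm.trans (dist_self x))

theorem exists_isometryEquiv [CompleteSpace X] [CompleteSpace Y] (hG : IsometricRel G)
    (hfst : Dense (Prod.fst '' G)) (hsnd : Dense (Prod.snd '' G)) :
    ∃ J : X ≃ᵢ Y, ∀ p ∈ G, J p.1 = p.2 := by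
  choose f hf using hG.exists_mem_closure hfst
  have hswap : Dense (Prod.fst '' (Prod.swap ⁻¹' G)) := by
    rwa [← image_swap_eq_preimage_swap, image_image]
  have hclosure : _root_.closure (Prod.swap ⁻¹' G) = Prod.swap ⁻¹' _root_.closure G :=
    ((Homeomorph.prodComm Y X).preimage_closure G).symm
  choose g hg using fun y => hclosure ▸ hG.swap.exists_mem_closure hswap y
  have hcl := hG.closure
  exact ⟨⟨⟨f, g, fun x => hcl.swap.snd_eq (hg (f x)) (hf x),
      fun y => hcl.snd_eq (hf (g y)) (hg y)⟩,
    Isometry.of_dist_eq fun x x' => (hcl _ (hf x) _ (hf x')).symm⟩,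
    fun p hp => hcl.snd_eq (hf p.1) (subset_closure hp)⟩

end IsometricRel

/-! ### Back and forth -/

/-- Every one-point metric extension of a finite subset is realized. -/
def HasOnePointExtensions (U : Type*) [PseudoMetricSpace U] : Prop :=
  ∀ (n : ℕ) (x : Fin n → U) (a : Fin n → ℝ), IsKatetov (fun i j => dist (x i) (x j)) a →
    ∃ u, ∀ i, dist (x i) u = a i

/-- The finite partial isometries, ordered by inclusion; the conditions of the back and forth. -/
abbrev PartialIsometry (X Y : Type*) [PseudoMetricSpace X] [PseudoMetricSpace Y] : Type _ :=
  {G : Set (X × Y) // G.Finite ∧ IsometricRel G}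

section PseudoMetric

variable {X Y : Type*} [PseudoMetricSpace X] [PseudoMetricSpace Y]

theorem HasOnePointExtensions.exists_dist_eq (hY : HasOnePointExtensions Y) {ι : Type*} [Finite ι]
    (x : ι → Y) {a : ι → ℝ} (ha : IsKatetov (fun i j => dist (x i) (x j)) a) :
    ∃ u, ∀ i, dist (x i) u = a i := by
  obtain ⟨n, ⟨e⟩⟩ := Finite.exists_equiv_fin ι
  obtain ⟨u, hu⟩ := hY n (x ∘ e.symm) (a ∘ e.symm) (ha.comp e.symm)
  exact ⟨u, fun i => by simpa using hu (e i)⟩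

theorem HasOnePointExtensions.exists_insert (hY : HasOnePointExtensions Y) {G : Set (X × Y)}
    (hfin : G.Finite) (hG : IsometricRel G) (x : X) : ∃ y, IsometricRel (insert (x, y) G) := by
  have := hfin.to_subtype
  have hkat : IsKatetov (fun p q : G => dist p.1.2 q.1.2) fun p : G => dist p.1.1 x :=
    fun p q => by
      simpa only [Function.comp_apply, hG p p.2 q q.2] using
        (isKatetov_dist_left x).comp (fun p : G => p.1.1) p q
  obtain ⟨y, hy⟩ := hY.exists_dist_eq (fun p : G => p.1.2) hkat
  exact ⟨y, hG.insert fun p hp => (hy ⟨p, hp⟩).symm⟩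

namespace PartialIsometry

theorem exists_isometricRel {ι : Type*} [Countable ι] (𝒟 : ι → Order.Cofinal (PartialIsometry X Y))
    (P : PartialIsometry X Y) :
    ∃ G : Set (X × Y), IsometricRel G ∧ P.1 ⊆ G ∧ ∀ i, ∃ Q ∈ 𝒟 i, Q.1 ⊆ G := by
  have := Encodable.ofCountable ι
  let I := Order.idealOfCofinals P 𝒟
  have hdir : Directed (· ⊆ ·) fun Q : I => Q.1.1 := fun Q R =>
    let ⟨S, hS, hQS, hRS⟩ := I.directed Q.1 Q.2 R.1 R.2
    ⟨⟨S, hS⟩, hQS, hRS⟩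
  refine ⟨⋃ Q : I, Q.1.1, .iUnion_of_directed hdir fun Q => Q.1.2.2,
    subset_iUnion (fun Q : I => Q.1.1) ⟨P, Order.mem_idealOfCofinals P 𝒟⟩, fun i => ?_⟩
  obtain ⟨Q, hQ, hQI⟩ := Order.cofinal_meets_idealOfCofinals P 𝒟 i
  exact ⟨Q, hQ, subset_iUnion (fun Q : I => Q.1.1) ⟨Q, hQI⟩⟩

/-- The partial isometries defined at `x`. -/
def definedAt (hY : HasOnePointExtensions Y) (x : X) : Order.Cofinal (PartialIsometry X Y) where
  carrier := {P | x ∈ Prod.fst '' P.1}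
  isCofinal P := by
    obtain ⟨y, hy⟩ := hY.exists_insert P.2.1 P.2.2 x
    exact ⟨⟨_, P.2.1.insert (x, y), hy⟩, ⟨(x, y), mem_insert _ _, rfl⟩, subset_insert _ _⟩

/-- The partial isometries with `y` in their range. -/
def attaining (hX : HasOnePointExtensions X) (y : Y) : Order.Cofinal (PartialIsometry X Y) where
  carrier := {P | y ∈ Prod.snd '' P.1}
  isCofinal P := by
    have hfin : (Prod.swap ⁻¹' P.1).Finite := P.2.1.preimage Prod.swap_injective.injOn
    obtain ⟨x, hx⟩ := hX.exists_insert hfin P.2.2.swap y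
    refine ⟨⟨_, P.2.1.insert (x, y), ?_⟩, ⟨(x, y), mem_insert _ _, rfl⟩, subset_insert _ _⟩
    convert hx.swap using 1
    ext ⟨x', y'⟩
    simp [and_comm]

end PartialIsometry

theorem HasOnePointExtensions.exists_isometry [TopologicalSpace.SeparableSpace X] [CompleteSpace Y]
    (hY : HasOnePointExtensions Y) : ∃ f : X → Y, Isometry f := by
  obtain ⟨s, hs, hsd⟩ := TopologicalSpace.exists_countable_dense X
  have := hs.to_subtype
  obtain ⟨G, hG, -, hdef⟩ := PartialIsometry.exists_isometricRel
    (fun x : s => PartialIsometry.definedAt hY x.1) ⟨∅, finite_empty, .empty⟩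
  refine hG.exists_isometry (hsd.mono fun x hx => ?_)
  obtain ⟨Q, hxQ, hQG⟩ := hdef ⟨x, hx⟩
  exact image_mono hQG hxQ

end PseudoMetric

section Metric

variable {X Y : Type*} [MetricSpace X] [MetricSpace Y]

theorem HasOnePointExtensions.exists_isometryEquiv [TopologicalSpace.SeparableSpace X]
    [TopologicalSpace.SeparableSpace Y] [CompleteSpace X] [CompleteSpace Y]
    (hX : HasOnePointExtensions X) (hY : HasOnePointExtensions Y) (P : PartialIsometry X Y) :
    ∃ J : X ≃ᵢ Y, ∀ p ∈ P.1, J p.1 = p.2 := by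
  obtain ⟨s, hs, hsd⟩ := TopologicalSpace.exists_countable_dense X
  obtain ⟨t, ht, htd⟩ := TopologicalSpace.exists_countable_dense Y
  have := hs.to_subtype
  have := ht.to_subtype
  obtain ⟨G, hG, hPG, hmeet⟩ := PartialIsometry.exists_isometricRel
    (Sum.elim (fun x : s => PartialIsometry.definedAt hY x.1)
      fun y : t => PartialIsometry.attaining hX y.1) P
  have hfst : Dense (Prod.fst '' G) := hsd.mono fun x hx =>
    let ⟨_, hxQ, hQG⟩ := hmeet (.inl ⟨x, hx⟩)
    image_mono hQG hxQ
  have hsnd : Dense (Prod.snd '' G) := htd.mono fun y hy =>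
    let ⟨_, hyQ, hQG⟩ := hmeet (.inr ⟨y, hy⟩)
    image_mono hQG hyQ
  obtain ⟨J, hJ⟩ := hG.exists_isometryEquiv hfst hsnd
  exact ⟨J, fun p hp => hJ p (hPG hp)⟩

/-! ### The Urysohn space -/

theorem HasOnePointExtensions.isUrysohn [TopologicalSpace.SeparableSpace Y] [CompleteSpace Y]
    (hY : HasOnePointExtensions Y) : IsUrysohn Y where
  complete := inferInstance
  separable := inferInstance
  universal _ := hY.exists_isometry
  homogeneous m a b hab := by
    have hG : IsometricRel (range fun i => (a i, b i)) := by
      rintro _ ⟨i, rfl⟩ _ ⟨j, rfl⟩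
      exact hab i j
    obtain ⟨J, hJ⟩ := hY.exists_isometryEquiv hY ⟨_, finite_range _, hG⟩
    exact ⟨J, fun i => hJ _ ⟨i, rfl⟩⟩

theorem IsUrysohn.hasOnePointExtensions (hY : IsUrysohn Y) : HasOnePointExtensions Y := by
  intro n x a ha
  let : PseudoMetricSpace (Fin n) := .induced x inferInstance
  let : PseudoMetricSpace (Option (Fin n)) := ha.pseudoMetricSpaceOption
  have : Finite (SeparationQuotient (Option (Fin n))) := Quotient.finite _
  obtain ⟨f, hf⟩ := hY.universal (SeparationQuotient (Option (Fin n)))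
  have hdist : ∀ p q : Option (Fin n),
      dist (f (SeparationQuotient.mk p)) (f (SeparationQuotient.mk q)) = dist p q := fun p q => by
    rw [hf.dist_eq, SeparationQuotient.dist_mk]
  obtain ⟨J, hJ⟩ := hY.homogeneous n (fun i => f (SeparationQuotient.mk (some i))) x
    fun i j => hdist _ _
  exact ⟨J (f (SeparationQuotient.mk none)), fun i => by
    rw [← hJ i, J.isometry.dist_eq]
    exact hdist (some i) none⟩

theorem IsUrysohn.nonempty_isometryEquiv (hX : IsUrysohn X) (hY : IsUrysohn Y) :
    Nonempty (X ≃ᵢ Y) := by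
  have := hX.complete
  have := hX.separable
  have := hY.complete
  have := hY.separable
  obtain ⟨J, -⟩ := hX.hasOnePointExtensions.exists_isometryEquiv hY.hasOnePointExtensions
    ⟨∅, finite_empty, .empty⟩
  exact ⟨J⟩

end Metric

/-! ### From approximate to exact extensions -/

/-- Every one-point metric extension of a finite subset is realized up to an arbitrarily small
error. -/
def HasApproxOnePointExtensions (U : Type*) [PseudoMetricSpace U] : Prop :=
  ∀ ε : ℝ, 0 < ε → ∀ (n : ℕ) (x : Fin n → U) (a : Fin n → ℝ),
    IsKatetov (fun i j => dist (x i) (x j)) a → ∃ u, ∀ i, |dist (x i) u - a i| < ε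

section Approximation

variable {Y : Type*} [PseudoMetricSpace Y] {n : ℕ} {x : Fin n → Y} {a : Fin n → ℝ}

-- The new value is the distance, in the sup metric on Katětov functions, from `a` to the Katětov
-- function of `u`.
theorem IsKatetov.snoc (ha : IsKatetov (fun i j => dist (x i) (x j)) a) (u : Y) :
    IsKatetov (fun i j => dist ((Fin.snoc x u : Fin (n + 1) → Y) i) ((Fin.snoc x u : _ → Y) j))
      (Fin.snoc a (dist (fun i => dist (x i) u) a) : Fin (n + 1) → ℝ) := by
  set s := dist (fun i => dist (x i) u) a with hs
  have hu : IsKatetov (fun i j => dist (x i) (x j)) fun i => dist (x i) u :=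
    (isKatetov_dist_left u).comp x
  have hle : ∀ i, |dist (x i) u - a i| ≤ s := dist_le_pi_dist (fun i => dist (x i) u) a
  have hge : ∀ i, s ≤ a i + dist (x i) u := fun i => by
    rw [hs, dist_pi_le_iff (add_nonneg (ha.nonneg i) dist_nonneg), add_comm]
    exact fun j => hu.abs_sub_le_add ha j i
  intro i j
  refine Fin.lastCases ?_ (fun i => ?_) i <;> refine Fin.lastCases ?_ (fun j => ?_) j <;>
    simp only [Fin.snoc_last, Fin.snoc_castSucc]
  · simp [hs]
  · obtain ⟨h₁, h₂⟩ := abs_le.1 (hle j)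
    rw [dist_comm u, abs_le]
    exact ⟨⟨by linarith, by linarith [hge j]⟩, by linarith⟩
  · obtain ⟨h₁, h₂⟩ := abs_le.1 (hle i)
    rw [abs_le]
    exact ⟨⟨by linarith [hge i], by linarith⟩, by linarith⟩
  · exact ha i j

theorem HasApproxOnePointExtensions.exists_refine (hY : HasApproxOnePointExtensions Y)
    (ha : IsKatetov (fun i j => dist (x i) (x j)) a) {δ : ℝ} (hδ : 0 < δ) (u : Y) :
    ∃ v, dist (fun i => dist (x i) v) a ≤ δ ∧
      dist u v ≤ dist (fun i => dist (x i) u) a + δ := by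
  obtain ⟨v, hv⟩ := hY δ hδ (n + 1) _ _ (ha.snoc u)
  refine ⟨v, (dist_pi_le_iff hδ.le).2 fun i => ?_, ?_⟩
  · simpa [Real.dist_eq] using (hv i.castSucc).le
  · have h := (abs_lt.1 (hv (Fin.last n))).2
    simp only [Fin.snoc_last] at h
    linarith

theorem HasApproxOnePointExtensions.hasOnePointExtensions [CompleteSpace Y]
    (hY : HasApproxOnePointExtensions Y) : HasOnePointExtensions Y := by
  intro n x a ha
  let dev : Y → ℝ := fun u => dist (fun i => dist (x i) u) a
  have hpos : ∀ k : ℕ, (0 : ℝ) < (1 / 2) ^ k := fun k => by positivity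
  obtain ⟨u₀, hu₀⟩ := hY 1 one_pos n x a ha
  choose F hdev hdist using fun k => hY.exists_refine ha (hpos (k + 1))
  let s : ℕ → Y := fun k => Nat.rec u₀ F k
  have hs : ∀ k, dev (s k) ≤ (1 / 2) ^ k := by
    rintro (_ | k)
    · simpa using (dist_pi_le_iff zero_le_one).2 fun i => (hu₀ i).le
    · exact hdev k (s k)
  have hstep : ∀ k, dist (s k) (s (k + 1)) ≤ 2 * (1 / 2) ^ k := fun k => by
    refine (hdist k (s k)).trans ?_
    linarith [hs k, pow_succ (1 / 2 : ℝ) k, hpos k]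
  obtain ⟨u, hu⟩ := cauchySeq_tendsto_of_complete
    (cauchySeq_of_le_geometric _ _ one_half_lt_one hstep)
  have hdev₀ : Tendsto (fun k => dev (s k)) atTop (𝓝 0) :=
    squeeze_zero (fun _ => dist_nonneg) hs
      (tendsto_pow_atTop_nhds_zero_of_lt_one (by norm_num) one_half_lt_one)
  have hcont : Continuous dev := by fun_prop
  have hzero : dev u = 0 := tendsto_nhds_unique ((hcont.tendsto u).comp hu) hdev₀
  exact ⟨u, congrFun (dist_eq_zero.1 hzero)⟩

end Approximation

/-! ### The completion of the integers -/

/-- The point of the completion given by an integer. -/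
def completedPoint (r : distCone) (i : ℕ) : Completed r :=
  UniformSpace.Completion.coe' (α := Points r) i

theorem dist_completedPoint (r : distCone) (i j : ℕ) :
    dist (completedPoint r i) (completedPoint r j) = r.1 i j :=
  UniformSpace.Completion.dist_eq _ _

theorem denseRange_completedPoint (r : distCone) : DenseRange (completedPoint r) :=
  UniformSpace.Completion.denseRange_coe (α := Points r)

theorem IsUniversal.hasApproxOnePointExtensions {r : distCone} (hr : IsUniversal r) :
    HasApproxOnePointExtensions (Completed r) := by
  intro ε hε n x a ha
  rcases n with _ | n
  · exact ⟨completedPoint r 0, fun i => i.elim0⟩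
  obtain ⟨f, hf, hfx⟩ := ha.exists_extension
  choose p hp using fun i =>
    (denseRange_completedPoint r).exists_dist_lt (x i) (show 0 < ε / 3 by positivity)
  obtain ⟨N, hN⟩ : ∃ N, ∀ i, p i < N :=
    ⟨Finset.univ.sup p + 1, fun i => Nat.lt_succ_of_le (Finset.le_sup (Finset.mem_univ i))⟩
  have hadm : (fun i : Fin N => f (completedPoint r i)) ∈ admissible (corner N r.1) :=
    fun i j => by
      simpa only [dist_completedPoint, corner] using hf (completedPoint r i) (completedPoint r j)
  obtain ⟨m, hm⟩ := hr (ε / 3) (by positivity) N _ hadm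
  refine ⟨completedPoint r m, fun i => ?_⟩
  have hm' : |dist (completedPoint r (p i)) (completedPoint r m) - f (completedPoint r (p i))|
      < ε / 3 := by
    rw [dist_completedPoint]
    exact hm ⟨p i, hN i⟩
  have hfp := (hf (completedPoint r (p i)) (x i)).1
  have hdist := abs_dist_sub_le (x i) (completedPoint r (p i)) (completedPoint r m)
  rw [hfx, dist_comm] at hfp
  calc |dist (x i) (completedPoint r m) - a i|
      ≤ |dist (x i) (completedPoint r m) - dist (completedPoint r (p i)) (completedPoint r m)|
        + |dist (completedPoint r (p i)) (completedPoint r m) - f (completedPoint r (p i))|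
        + |f (completedPoint r (p i)) - a i| :=
        (abs_sub_le _ _ _).trans (add_le_add_left (abs_sub_le _ _ _) _)
    _ < ε := by linarith [hp i]

theorem IsUniversal.isUrysohn {r : distCone} (hr : IsUniversal r) : IsUrysohn (Completed r) := by
  have : Countable (Points r) := inferInstanceAs (Countable ℕ)
  exact hr.hasApproxOnePointExtensions.hasOnePointExtensions.isUrysohn

/-! ### The order of the entries -/

theorem entryIndex_succ (i j : ℕ) : entryIndex (i + 1) j = entryIndex i j + 1 :=
  rfl

theorem entryIndex_zero_succ (j : ℕ) : entryIndex 0 (j + 1) = entryIndex j j := by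
  simp [entryIndex, Nat.choose_succ_succ' j 1, add_comm]

theorem entryIndex_mono (i : ℕ) : Monotone (entryIndex i) :=
  fun _ _ h => Nat.add_le_add_right (Nat.choose_mono 2 h) i

theorem entryIndex_lt_of_lt_left {i i' : ℕ} (h : i < i') (j : ℕ) :
    entryIndex i j < entryIndex i' j :=
  Nat.add_lt_add_left h _

theorem entryIndex_lt_entryIndex_zero {i j m : ℕ} (hij : i < j) (hjm : j < m) :
    entryIndex i j < entryIndex 0 m :=
  calc entryIndex i j < entryIndex j j := entryIndex_lt_of_lt_left hij j
    _ = entryIndex 0 (j + 1) := (entryIndex_zero_succ j).symm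
    _ ≤ entryIndex 0 m := entryIndex_mono 0 hjm

theorem exists_entryIndex_eq_add_one (i : ℕ) {j : ℕ} (hj : 1 < j) :
    ∃ t, entryIndex i j = t + 1 :=
  Nat.exists_eq_add_one.2 <| calc
    0 ≤ entryIndex 0 1 := Nat.zero_le _
    _ < entryIndex 0 j := entryIndex_lt_entryIndex_zero Nat.zero_lt_one hj
    _ ≤ entryIndex i j := Nat.add_le_add_left (Nat.zero_le i) _

theorem entryAt_entryIndex {i j : ℕ} (hij : i < j) : entryAt (entryIndex i j) = (i, j) := by
  induction j generalizing i with
  | zero => omega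
  | succ j ihj =>
    induction i with
    | zero =>
      rcases j with _ | j
      · rfl
      · rw [entryIndex_zero_succ, entryIndex_succ, entryAt, ihj j.lt_succ_self]
        simp
    | succ i ihi =>
      rw [entryIndex_succ, entryAt, ihi (by omega)]
      simp [hij]

/-! ### Matrices of entries -/

theorem toMatrix_self (x : ℕ → ℝ) (i : ℕ) : toMatrix x i i = 0 := by simp [toMatrix]

theorem toMatrix_of_lt (x : ℕ → ℝ) {i j : ℕ} (h : i < j) :
    toMatrix x i j = x (entryIndex i j) :=
  if_pos h

theorem toMatrix_comm (x : ℕ → ℝ) (i j : ℕ) : toMatrix x i j = toMatrix x j i := by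
  rcases lt_trichotomy i j with h | rfl | h
  · simp [toMatrix, h, h.not_gt]
  · rfl
  · simp [toMatrix, h, h.not_gt]

theorem fragment_frestrictLe (x : ℕ → ℝ) {t i j : ℕ} (hij : i < j) (ht : entryIndex i j ≤ t) :
    fragment t (Preorder.frestrictLe t x) i j = toMatrix x i j := by
  rw [fragment, toMatrix_of_lt _ hij, toMatrix_of_lt _ hij, dif_pos (Finset.mem_Iic.2 ht)]
  rfl

theorem lower_congr {k j : ℕ} {q r : ℕ → ℕ → ℝ} (h₁ : ∀ i ≤ k, q i (k + 1) = r i (k + 1))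
    (h₂ : ∀ i ≤ k, q i j = r i j) : lower k j q = lower k j r :=
  Finset.sup'_congr _ rfl fun i hi => by
    have hik := Finset.mem_range_succ_iff.1 hi
    rw [h₁ i hik, h₂ i hik]

theorem upper_congr {k j : ℕ} {q r : ℕ → ℕ → ℝ} (h₁ : ∀ i ≤ k, q i (k + 1) = r i (k + 1))
    (h₂ : ∀ i ≤ k, q i j = r i j) : upper k j q = upper k j r :=
  Finset.inf'_congr _ rfl fun i hi => by
    have hik := Finset.mem_range_succ_iff.1 hi
    rw [h₁ i hik, h₂ i hik]

theorem stepKernel_apply (γ : Measure ℝ≥0) {t i j : ℕ} (hij : i < j)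
    (ht : entryIndex i j = t + 1) (a : Finset.Iic t → ℝ) :
    stepKernel γ t a = entryKernel γ i j (fragment t a) := by
  rw [stepKernel, Kernel.comap_apply, ← ht, entryAt_entryIndex hij]

theorem bounds_fragment_frestrictLe (x : ℕ → ℝ) {t k j : ℕ} (hkj : k + 1 < j)
    (ht : entryIndex (k + 1) j = t + 1) :
    lower k j (fragment t (Preorder.frestrictLe t x)) = lower k j (toMatrix x) ∧
      upper k j (fragment t (Preorder.frestrictLe t x)) = upper k j (toMatrix x) := by
  have hle : ∀ {i j'}, entryIndex i j' < entryIndex (k + 1) j → entryIndex i j' ≤ t := fun h =>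
    Nat.le_of_lt_succ (h.trans_eq ht)
  have hcol : ∀ i ≤ k, fragment t (Preorder.frestrictLe t x) i (k + 1) = toMatrix x i (k + 1) :=
    fun i hi => fragment_frestrictLe x (Nat.lt_succ_of_le hi) <| hle <|
      (entryIndex_lt_entryIndex_zero (Nat.lt_succ_of_le hi) hkj).trans
        (entryIndex_lt_of_lt_left k.succ_pos j)
  have hrow : ∀ i ≤ k, fragment t (Preorder.frestrictLe t x) i j = toMatrix x i j :=
    fun i hi => fragment_frestrictLe x (by omega) <| hle <|
      entryIndex_lt_of_lt_left (Nat.lt_succ_of_le hi) j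
  exact ⟨lower_congr hcol hrow, upper_congr hcol hrow⟩

theorem stepKernel_frestrictLe (γ : Measure ℝ≥0) (x : ℕ → ℝ) {t i j : ℕ} (hij : i < j)
    (ht : entryIndex i j = t + 1) :
    stepKernel γ t (Preorder.frestrictLe t x) = entryKernel γ i j (toMatrix x) := by
  rw [stepKernel_apply γ hij ht]
  rcases i with _ | k
  · rfl
  · obtain ⟨hlower, hupper⟩ := bounds_fragment_frestrictLe x hij ht
    simp only [entryKernel, Kernel.comap_apply, hlower, hupper]

/-! ### The triangle inequality -/

section Segment

variable {k n : ℕ} {r : ℕ → ℕ → ℝ}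

theorem lower_le_iff {c : ℝ} : lower k n r ≤ c ↔ ∀ i ≤ k, |r i (k + 1) - r i n| ≤ c := by
  simp [lower, Finset.sup'_le_iff]

theorem le_upper_iff {c : ℝ} : c ≤ upper k n r ↔ ∀ i ≤ k, c ≤ r i (k + 1) + r i n := by
  simp [upper, Finset.le_inf'_iff]

theorem lower_le_upper (hk : IsKatetov (corner (k + 1) r) fun i => r i (k + 1))
    (hn : IsKatetov (corner (k + 1) r) fun i => r i n) : lower k n r ≤ upper k n r :=
  lower_le_iff.2 fun i hi => le_upper_iff.2 fun j hj =>
    hk.abs_sub_le_add hn ⟨i, Nat.lt_succ_of_le hi⟩ ⟨j, Nat.lt_succ_of_le hj⟩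

theorem isKatetov_corner_succ (hself : ∀ i, r i i = 0) (hcomm : ∀ i j, r i j = r j i)
    (hn : IsKatetov (corner (k + 1) r) fun i => r i n)
    (hseg : r (k + 1) n ∈ Icc (lower k n r) (upper k n r)) :
    IsKatetov (corner (k + 2) r) fun i => r i n := by
  have hl : ∀ i : Fin (k + 1), |r i (k + 1) - r i n| ≤ r (k + 1) n := fun i =>
    lower_le_iff.1 hseg.1 i i.is_le
  have hu : ∀ i : Fin (k + 1), r (k + 1) n ≤ r i (k + 1) + r i n := fun i =>
    le_upper_iff.1 hseg.2 i i.is_le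
  have hmix : ∀ i : Fin (k + 1), |r i n - r (k + 1) n| ≤ r i (k + 1) ∧
      r i (k + 1) ≤ r i n + r (k + 1) n := fun i => by
    obtain ⟨h₁, h₂⟩ := abs_le.1 (hl i)
    exact ⟨abs_le.2 ⟨by linarith [hu i], by linarith⟩, by linarith⟩
  intro i j
  refine Fin.lastCases ?_ (fun i => ?_) i <;> refine Fin.lastCases ?_ (fun j => ?_) j <;>
    simp only [corner, Fin.val_last, Fin.val_castSucc]
  · simpa [hself] using (abs_nonneg _).trans (hl 0)
  · rw [abs_sub_comm, add_comm (r _ n), hcomm (k + 1) j]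
    exact hmix j
  · exact hmix i
  · exact hn i j

end Segment

theorem isKatetov_of_mem_distCone {r : ℕ → ℕ → ℝ} (hr : r ∈ distCone) (m : ℕ) :
    IsKatetov r fun i => r i m := by
  obtain ⟨-, -, hcomm, htri⟩ := hr
  refine fun i j => ⟨abs_sub_le_iff.2 ⟨?_, ?_⟩, ?_⟩
  · linarith [htri i m j]
  · linarith [htri j m i, hcomm i j]
  · linarith [htri i j m, hcomm m j]

theorem mem_distCone_of_isKatetov {r : ℕ → ℕ → ℝ} (hself : ∀ i, r i i = 0)
    (hcomm : ∀ i j, r i j = r j i) (hcol : ∀ n, IsKatetov (corner n r) fun i => r i n) :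
    r ∈ distCone := by
  have hnonneg : ∀ i j, 0 ≤ r i j := fun i j => by
    rcases lt_trichotomy i j with h | rfl | h
    · exact (hcol j).nonneg ⟨i, h⟩
    · exact (hself i).ge
    · exact hcomm i j ▸ (hcol i).nonneg ⟨j, h⟩
  refine ⟨hself, hnonneg, hcomm, fun i j k => ?_⟩
  wlog hij : i ≤ j generalizing i j
  · rw [hcomm i j, hcomm i k, hcomm k j, add_comm]
    exact this j i (le_of_not_ge hij)
  rcases lt_trichotomy k j with hk | rfl | hk
  · rcases hij.lt_or_eq with hij | rfl
    · exact sub_le_iff_le_add.1 ((hcol j).sub_le ⟨i, hij⟩ ⟨k, hk⟩)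
    · exact hself i ▸ add_nonneg (hnonneg i k) (hnonneg k i)
  · rw [hself, add_zero]
  · exact hcomm k j ▸ (hcol k).le_add ⟨i, hij.trans_lt hk⟩ ⟨j, hk⟩

theorem mem_distCone_of_mem_segment {r : ℕ → ℕ → ℝ} (hself : ∀ i, r i i = 0)
    (hcomm : ∀ i j, r i j = r j i) (h0 : ∀ j, 0 ≤ r 0 j)
    (hseg : ∀ k n, k + 1 < n → lower k n r ≤ upper k n r →
      r (k + 1) n ∈ Icc (lower k n r) (upper k n r)) : r ∈ distCone := by
  refine mem_distCone_of_isKatetov hself hcomm fun n => ?_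
  induction n using Nat.strong_induction_on with
  | _ n ih =>
    have hfirst : ∀ k < n, IsKatetov (corner (k + 1) r) fun i => r i n := by
      intro k hk
      induction k with
      | zero =>
        intro i j
        simpa [corner, hself] using h0 n
      | succ k ihk =>
        have hprev := ihk (by omega)
        exact isKatetov_corner_succ hself hcomm hprev
          (hseg k n hk (lower_le_upper (ih (k + 1) hk) hprev))
    rcases n with _ | n
    · exact fun i => i.elim0
    · exact hfirst n n.lt_succ_self

theorem measurableSet_distCone : MeasurableSet distCone := by
  unfold distCone
  measurability

/-! ### Approximately admissible vectors -/

/-- The matrices for which the first `n` entries of `b` are admissible up to the error `2 * η`. -/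
def nearAdmissible (n : ℕ) (b : ℕ → ℝ) (η : ℝ) : Set (ℕ → ℕ → ℝ) :=
  {q | ∀ i < n, ∀ j < n, |b i - b j| ≤ q i j + 2 * η ∧ q i j ≤ b i + b j + 2 * η}

/-- The error allowed in the `i`-th entry of a column approximating a vector which is admissible up
to `2 * η`. Each entry is chosen in a segment determined by the preceding ones, so that the errors
accumulate. -/
def tolerance (η : ℝ) (i : ℕ) : ℝ := (3 * i + 1) * η

/-- The matrices whose column `m` approximates `b` in its first `n` entries. -/
def columnNear (n m : ℕ) (b : ℕ → ℝ) (η : ℝ) : Set (ℕ → ℕ → ℝ) :=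
  {q | ∀ i < n, |q i m - b i| ≤ tolerance η i}

theorem tolerance_zero (η : ℝ) : tolerance η 0 = η := by simp [tolerance]

theorem tolerance_mono {η : ℝ} (hη : 0 ≤ η) : Monotone (tolerance η) := fun i j hij => by
  unfold tolerance
  gcongr

theorem tolerance_succ (η : ℝ) (i : ℕ) : tolerance η (i + 1) = tolerance η i + 3 * η := by
  simp only [tolerance]
  push_cast
  ring

theorem Icc_inter_closedBall_nonempty {a b x δ : ℝ} (hab : a ≤ b) (hδ : 0 ≤ δ) (ha : a ≤ x + δ)
    (hb : x - δ ≤ b) : (Icc a b ∩ Metric.closedBall x δ).Nonempty := by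
  rw [Real.closedBall_eq_Icc, Icc_inter_Icc, nonempty_Icc]
  exact sup_le (le_inf hab ha) (le_inf hb (by linarith))

section Near

variable {n m k : ℕ} {b : ℕ → ℝ} {η : ℝ} {r : ℕ → ℕ → ℝ}

theorem columnNear_succ : columnNear (n + 1) m b η =
    columnNear n m b η ∩ {q | q n m ∈ Metric.closedBall (b n) (tolerance η n)} := by
  ext q
  simp only [columnNear, mem_ofPred_eq, mem_inter_iff, Nat.forall_lt_succ_right,
    Metric.mem_closedBall, Real.dist_eq]

theorem segment_inter_closedBall_nonempty (hη : 0 ≤ η) (hr : r ∈ distCone)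
    (hb : r ∈ nearAdmissible n b η) (hk : k + 1 < n) (hm : r ∈ columnNear (k + 1) m b η) :
    (Icc (lower k m r) (upper k m r) ∩
      Metric.closedBall (b (k + 1)) (tolerance η (k + 1) - η)).Nonempty := by
  have hle : lower k m r ≤ upper k m r :=
    lower_le_upper ((isKatetov_of_mem_distCone hr (k + 1)).comp Fin.val)
      ((isKatetov_of_mem_distCone hr m).comp Fin.val)
  have htol : ∀ i ≤ k, tolerance η i + 2 * η ≤ tolerance η (k + 1) - η := fun i hi => by
    linarith [tolerance_mono hη hi, tolerance_succ η k]
  have hpos : 0 ≤ tolerance η (k + 1) - η := by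
    linarith [htol 0 k.zero_le, tolerance_zero η]
  have hentry : ∀ i ≤ k, |r i (k + 1) - r i m| ≤ b (k + 1) + (tolerance η (k + 1) - η) ∧
      b (k + 1) - (tolerance η (k + 1) - η) ≤ r i (k + 1) + r i m := fun i hi => by
    obtain ⟨hm₁, hm₂⟩ := abs_le.1 (hm i (Nat.lt_succ_of_le hi))
    obtain ⟨hdist, hadd⟩ := hb i (by omega) (k + 1) hk
    obtain ⟨hb₁, hb₂⟩ := abs_le.1 hdist
    have htol_i := htol i hi
    exact ⟨abs_le.2 ⟨by linarith, by linarith⟩, by linarith⟩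
  exact Icc_inter_closedBall_nonempty hle hpos (lower_le_iff.2 fun i hi => (hentry i hi).1)
    (le_upper_iff.2 fun i hi => (hentry i hi).2)

theorem upper_sub_lower_le (hb : r ∈ nearAdmissible n b η) (hk : k + 1 < n)
    (hm : r ∈ columnNear (k + 1) m b η) :
    upper k m r - lower k m r ≤ 2 * b 0 + b (k + 1) + 3 * η := by
  have hupper : upper k m r ≤ r 0 (k + 1) + r 0 m := le_upper_iff.1 le_rfl 0 k.zero_le
  have hlower : 0 ≤ lower k m r := (abs_nonneg _).trans (lower_le_iff.1 le_rfl 0 k.zero_le)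
  have hadm : r 0 (k + 1) ≤ b 0 + b (k + 1) + 2 * η := (hb 0 (by omega) (k + 1) hk).2
  have hnear : r 0 m - b 0 ≤ η :=
    (le_abs_self _).trans (tolerance_zero η ▸ hm 0 k.succ_pos)
  linarith

end Near

theorem mem_nearAdmissible_of_admissible {r : ℕ → ℕ → ℝ} {n : ℕ} {a : Fin n → ℝ}
    (ha : a ∈ admissible (corner n r)) {b : ℕ → ℝ} {η : ℝ} (hb : ∀ i : Fin n, |b i - a i| ≤ η) :
    r ∈ nearAdmissible n b η := by
  intro i hi j hj
  obtain ⟨hdist, hadd⟩ := ha ⟨i, hi⟩ ⟨j, hj⟩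
  obtain ⟨hi₁, hi₂⟩ := abs_le.1 (hb ⟨i, hi⟩)
  obtain ⟨hj₁, hj₂⟩ := abs_le.1 (hb ⟨j, hj⟩)
  obtain ⟨hd₁, hd₂⟩ := abs_le.1 hdist
  simp only [corner] at *
  exact ⟨abs_le.2 ⟨by linarith, by linarith⟩, by linarith⟩

theorem exists_mem_forall_abs_sub_lt {S : Set (ℕ → ℝ≥0)} (hS : Dense S) {n : ℕ} {a : Fin n → ℝ}
    (ha : ∀ i, 0 ≤ a i) {η : ℝ} (hη : 0 < η) : ∃ b ∈ S, ∀ i : Fin n, |(b i : ℝ) - a i| < η := by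
  have hopen : IsOpen {b : ℕ → ℝ≥0 | ∀ i : Fin n, |(b i : ℝ) - a i| < η} := by
    simp only [ofPred_forall]
    exact isOpen_iInter_of_finite fun i => isOpen_lt (by fun_prop) continuous_const
  refine hS.exists_mem_open hopen ⟨Function.extend Fin.val (fun i => (a i).toNNReal) 0, fun i => ?_⟩
  rw [Fin.val_injective.extend_apply, Real.coe_toNNReal _ (ha i), sub_self, abs_zero]
  exact hη

theorem isUniversal_of_nearAdmissible {r : distCone} {S : Set (ℕ → ℝ≥0)} (hS : Dense S)
    (h : ∀ b ∈ S, ∀ n N : ℕ, r.1 ∈ nearAdmissible n (fun i => b i) (1 / (N + 1)) →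
      ∃ m, r.1 ∈ columnNear n m (fun i => b i) (1 / (N + 1))) :
    IsUniversal r := by
  intro ε hε n a ha
  have hn : (0 : ℝ) < 3 * n + 2 := by positivity
  obtain ⟨N, hN⟩ := exists_nat_one_div_lt (div_pos hε hn)
  have hη : (0 : ℝ) < 1 / (N + 1) := by positivity
  set η : ℝ := 1 / (N + 1)
  obtain ⟨b, hbS, hb⟩ := exists_mem_forall_abs_sub_lt hS (IsKatetov.nonneg ha) hη
  obtain ⟨m, hm⟩ := h b hbS n N (mem_nearAdmissible_of_admissible ha fun i => (hb i).le)
  refine ⟨m, fun i => ?_⟩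
  calc |r.1 i m - a i| ≤ |r.1 i m - b i| + |b i - a i| := abs_sub_le _ _ _
    _ < tolerance η n + η :=
      add_lt_add_of_le_of_lt ((hm i i.2).trans (tolerance_mono hη.le i.2.le)) (hb i)
    _ = η * (3 * n + 2) := by rw [tolerance]; ring
    _ < ε := (lt_div_iff₀ hn).1 hN

/-! ### Uniform distributions -/

theorem ae_unif_mem_Icc {a b : ℝ} (hab : a ≤ b) : ∀ᵐ y ∂unif a b, y ∈ Icc a b := by
  unfold unif
  split_ifs with h
  · exact Measure.ae_smul_measure (ae_restrict_mem measurableSet_Icc) _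
  · rw [ae_dirac_eq]
    exact left_mem_Icc.2 hab

theorem ofReal_min_le_volume_Icc_inter_closedBall {a b c η : ℝ} (hc : c ∈ Icc a b) (hη : 0 ≤ η) :
    ENNReal.ofReal (min η (b - a)) ≤ volume (Icc a b ∩ Metric.closedBall c η) := by
  obtain ⟨hac, hcb⟩ := hc
  rw [Real.closedBall_eq_Icc, Icc_inter_Icc, Real.volume_Icc]
  refine ENNReal.ofReal_le_ofReal ?_
  change min η (b - a) ≤ min b (c + η) - max a (c - η)
  grind

theorem le_unif_closedBall {a b c η M : ℝ} (hc : c ∈ Icc a b) (hη : 0 < η) (hM : b - a ≤ M) :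
    ENNReal.ofReal (η / (η + M)) ≤ unif a b (Metric.closedBall c η) := by
  have hM₀ : 0 ≤ M := by linarith [hc.1, hc.2]
  unfold unif
  split_ifs with h
  · have hab : 0 < b - a := sub_pos.2 h
    have hmin : η / (η + M) ≤ (b - a)⁻¹ * min η (b - a) := by
      rw [div_le_iff₀ (by positivity), mul_assoc, le_inv_mul_iff₀ hab]
      rcases min_cases η (b - a) with ⟨hmin, -⟩ | ⟨hmin, -⟩ <;> rw [hmin] <;> nlinarith
    rw [Measure.smul_apply, smul_eq_mul, Measure.restrict_apply measurableSet_closedBall,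
      Real.volume_Icc, ← ENNReal.ofReal_inv_of_pos hab, inter_comm]
    calc ENNReal.ofReal (η / (η + M))
        ≤ ENNReal.ofReal (b - a)⁻¹ * ENNReal.ofReal (min η (b - a)) := by
          rw [← ENNReal.ofReal_mul (inv_nonneg.2 hab.le)]
          exact ENNReal.ofReal_le_ofReal hmin
      _ ≤ _ := by
          gcongr
          exact ofReal_min_le_volume_Icc_inter_closedBall hc hη.le
  · have hca : c = a := by linarith [hc.1, hc.2]
    rw [Measure.dirac_apply_of_mem (hca ▸ Metric.mem_closedBall_self hη.le), ENNReal.ofReal_le_one]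
    exact div_le_one_of_le₀ (by linarith) (by positivity)

/-! ### Trajectories of Markov kernels -/

section Trajectory

variable {X : ℕ → Type*} [∀ n, MeasurableSpace (X n)] (μ₀ : Measure (X 0))
  (κ : (n : ℕ) → Kernel ((i : Finset.Iic n) → X i) (X (n + 1))) [∀ n, IsMarkovKernel (κ n)]

theorem map_eval_zero_trajMeasure : (Kernel.trajMeasure μ₀ κ).map (fun x => x 0) = μ₀ := by
  have hrestrict : (Kernel.trajMeasure μ₀ κ).map (Preorder.frestrictLe 0) =
      μ₀.map (MeasurableEquiv.piUnique fun i : Finset.Iic 0 => X i).symm := by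
    rw [Kernel.trajMeasure, Measure.map_comp _ _ (by fun_prop), Kernel.traj_map_frestrictLe,
      Kernel.partialTraj_self, Measure.id_comp]
    rfl
  calc (Kernel.trajMeasure μ₀ κ).map (fun x => x 0)
      = ((Kernel.trajMeasure μ₀ κ).map (Preorder.frestrictLe 0)).map
          fun a => a ⟨0, Finset.mem_Iic.2 le_rfl⟩ := by
        rw [Measure.map_map (by fun_prop) (by fun_prop)]
        rfl
    _ = μ₀.map id := by
        rw [hrestrict]
        exact Measure.map_map (measurable_pi_apply _) (MeasurableEquiv.measurable _)
    _ = μ₀ := Measure.map_id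

variable [IsProbabilityMeasure μ₀]

theorem ae_trajMeasure_of_ae_kernel {t : ℕ} {P : ((i : Finset.Iic t) → X i) × X (t + 1) → Prop}
    (hP : MeasurableSet {p | P p}) (h : ∀ a, ∀ᵐ y ∂κ t a, P (a, y)) :
    ∀ᵐ x ∂Kernel.trajMeasure μ₀ κ, P (Preorder.frestrictLe t x, x (t + 1)) := by
  have hprod := Measure.ae_compProd_of_ae_ae
    (μ := (Kernel.trajMeasure μ₀ κ).map (Preorder.frestrictLe t)) hP (Eventually.of_forall h)
  rw [Kernel.map_frestrictLe_trajMeasure_compProd_eq_map_trajMeasure] at hprod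
  exact ae_of_ae_map (by fun_prop) hprod

theorem mul_trajMeasure_le {t : ℕ} {A : Set ((n : ℕ) → X n)}
    (hA : MeasurableSet[Filtration.piLE t] A) {B : Set (X (t + 1))} (hB : MeasurableSet B)
    {c : ℝ≥0∞} (hc : ∀ᵐ x ∂Kernel.trajMeasure μ₀ κ, x ∈ A → c ≤ κ t (Preorder.frestrictLe t x) B) :
    c * Kernel.trajMeasure μ₀ κ A ≤ Kernel.trajMeasure μ₀ κ (A ∩ {x | x (t + 1) ∈ B}) := by
  have hA' : MeasurableSet A := Filtration.piLE.le t _ hA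
  rw [Filtration.piLE_eq_comap_frestrictLe] at hA
  obtain ⟨H, hH, rfl⟩ := hA
  calc c * Kernel.trajMeasure μ₀ κ (Preorder.frestrictLe t ⁻¹' H)
      = ∫⁻ _ in Preorder.frestrictLe t ⁻¹' H, c ∂Kernel.trajMeasure μ₀ κ :=
        (setLIntegral_const _ _).symm
    _ ≤ ∫⁻ x in Preorder.frestrictLe t ⁻¹' H, κ t (Preorder.frestrictLe t x) B
          ∂Kernel.trajMeasure μ₀ κ := setLIntegral_mono_ae' hA' hc
    _ = ((Kernel.trajMeasure μ₀ κ).map (Preorder.frestrictLe t) ⊗ₘ κ t) (H ×ˢ B) := by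
        rw [Measure.compProd_apply_prod hH hB,
          setLIntegral_map hH (Kernel.measurable_coe _ hB) (by fun_prop)]
    _ = Kernel.trajMeasure μ₀ κ (Preorder.frestrictLe t ⁻¹' H ∩ {x | x (t + 1) ∈ B}) := by
        rw [Kernel.map_frestrictLe_trajMeasure_compProd_eq_map_trajMeasure,
          Measure.map_apply (by fun_prop) (hH.prod hB)]
        rfl

end Trajectory

theorem measure_sdiff_iUnion_eq_zero {α : Type*} [MeasurableSpace α] {μ : Measure α}
    [IsFiniteMeasure μ] {S : Set α} {E : ℕ → Set α} (hS : MeasurableSet S)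
    (hE : ∀ N, MeasurableSet (E N)) {p : ℝ≥0∞} (hp : p ≠ 0)
    (h : ∀ N, p * μ (S \ ⋃ l < N, E l) ≤ μ ((S \ ⋃ l < N, E l) ∩ E N)) :
    μ (S \ ⋃ l, E l) = 0 := by
  set T : ℕ → Set α := fun N => (S \ ⋃ l < N, E l) ∩ E N
  have hT : ∀ N, MeasurableSet (T N) := fun N =>
    (hS.diff (.iUnion fun l => .iUnion fun _ => hE l)).inter (hE N)
  have hdisj : Pairwise (Function.onFun Disjoint T) :=
    (pairwise_disjoint_on T).2 fun M N hMN => Set.disjoint_left.2 fun x hxM hxN =>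
      hxN.1.2 (mem_iUnion₂.2 ⟨M, hMN, hxM.2⟩)
  have hle : ∀ N, p * μ (S \ ⋃ l, E l) ≤ μ (T N) := fun N =>
    (mul_le_mul_right (measure_mono (sdiff_subset_sdiff_right
      (iUnion₂_subset fun l _ => subset_iUnion E l))) p).trans (h N)
  by_contra h0
  have hfin := Measure.finite_const_le_meas_of_disjoint_iUnion μ
    (pos_iff_ne_zero.2 (mul_ne_zero hp h0)) hT hdisj (measure_ne_top _ _)
  simp only [hle] at hfin
  exact infinite_univ hfin

/-! ### The law of the entries -/

section FirstRow

variable (γ : Measure ℝ≥0)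

theorem nullSingletonClass_map_coe [NullSingletonClass γ] :
    NullSingletonClass (γ.map ((↑) : ℝ≥0 → ℝ)) := by
  refine ⟨fun x => ?_⟩
  rw [Measure.map_apply (by fun_prop) (measurableSet_singleton x)]
  exact (subsingleton_singleton.preimage NNReal.coe_injective).measure_zero γ

theorem ae_map_coe_nonneg : ∀ᵐ y ∂γ.map ((↑) : ℝ≥0 → ℝ), 0 ≤ y :=
  (ae_map_iff (by fun_prop) measurableSet_Ici).2 (Eventually.of_forall NNReal.coe_nonneg)

end FirstRow

section EntryLaw

variable (γ : Measure ℝ≥0) [IsProbabilityMeasure γ]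

instance isProbabilityMeasure_map_coe : IsProbabilityMeasure (γ.map ((↑) : ℝ≥0 → ℝ)) :=
  Measure.isProbabilityMeasure_map (by fun_prop)

instance isProbabilityMeasure_entryLaw : IsProbabilityMeasure (entryLaw γ) := by
  unfold entryLaw
  infer_instance

theorem ae_entryLaw_of_ae_entryKernel {t i j : ℕ} (hij : i < j) (ht : entryIndex i j = t + 1)
    {P : (ℕ → ℕ → ℝ) × ℝ → Prop} (hP : MeasurableSet {p | P p})
    (h : ∀ q, ∀ᵐ y ∂entryKernel γ i j q, P (q, y)) :
    ∀ᵐ x ∂entryLaw γ, P (fragment t (Preorder.frestrictLe t x), toMatrix x i j) := by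
  simp only [toMatrix_of_lt _ hij, ht]
  refine ae_trajMeasure_of_ae_kernel (X := fun _ => ℝ) _ (stepKernel γ)
    (P := fun p => P (fragment t p.1, p.2))
    (((measurable_fragment t).comp measurable_fst).prodMk measurable_snd hP) fun a => ?_
  rw [stepKernel_apply γ hij ht]
  exact h _

theorem ae_toMatrix_zero_of_ae {P : ℝ → Prop} (hP : MeasurableSet {y | P y})
    (h : ∀ᵐ y ∂γ.map ((↑) : ℝ≥0 → ℝ), P y) {j : ℕ} (hj : 0 < j) :
    ∀ᵐ x ∂entryLaw γ, P (toMatrix x 0 j) := by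
  rcases (show 1 ≤ j from hj).eq_or_lt with rfl | hj
  · have hlaw : (entryLaw γ).map (fun x => x 0) = γ.map ((↑) : ℝ≥0 → ℝ) :=
      map_eval_zero_trajMeasure (X := fun _ => ℝ) _ _
    rw [← hlaw] at h
    exact ae_of_ae_map (measurable_pi_apply 0).aemeasurable h
  · obtain ⟨t, ht⟩ := exists_entryIndex_eq_add_one 0 hj
    exact ae_entryLaw_of_ae_entryKernel γ (P := fun p => P p.2) (by omega) ht
      (measurable_snd hP) fun _ => h

theorem ae_toMatrix_zero_nonneg : ∀ᵐ x ∂entryLaw γ, ∀ j, 0 ≤ toMatrix x 0 j := by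
  refine ae_all_iff.2 fun j => ?_
  rcases j.eq_zero_or_pos with rfl | hj
  · exact Eventually.of_forall fun x => (toMatrix_self x 0).ge
  · exact ae_toMatrix_zero_of_ae γ measurableSet_Ici (ae_map_coe_nonneg γ) hj

theorem ae_toMatrix_mem_segment : ∀ᵐ x ∂entryLaw γ, ∀ k j, k + 1 < j →
    lower k j (toMatrix x) ≤ upper k j (toMatrix x) →
      toMatrix x (k + 1) j ∈ Icc (lower k j (toMatrix x)) (upper k j (toMatrix x)) := by
  refine ae_all_iff.2 fun k => ae_all_iff.2 fun j => ae_all_iff.2 fun hkj => ?_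
  obtain ⟨t, ht⟩ := exists_entryIndex_eq_add_one (k + 1) (show 1 < j by omega)
  have hlower : Measurable fun p : (ℕ → ℕ → ℝ) × ℝ => lower k j p.1 :=
    (measurable_bounds k j).fst.comp measurable_fst
  have hupper : Measurable fun p : (ℕ → ℕ → ℝ) × ℝ => upper k j p.1 :=
    (measurable_bounds k j).snd.comp measurable_fst
  have h := ae_entryLaw_of_ae_entryKernel γ
    (P := fun p => lower k j p.1 ≤ upper k j p.1 → p.2 ∈ Icc (lower k j p.1) (upper k j p.1))
    hkj ht
    ((measurableSet_le hlower hupper).imp ((measurableSet_le hlower measurable_snd).inter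
      (measurableSet_le measurable_snd hupper)))
    fun _ => eventually_imp_distrib_left.2 ae_unif_mem_Icc
  filter_upwards [h] with x hx
  rwa [(bounds_fragment_frestrictLe x hkj ht).1, (bounds_fragment_frestrictLe x hkj ht).2] at hx

theorem ae_toMatrix_mem_distCone : ∀ᵐ x ∂entryLaw γ, toMatrix x ∈ distCone := by
  filter_upwards [ae_toMatrix_zero_nonneg γ, ae_toMatrix_mem_segment γ] with x h0 hseg
  exact mem_distCone_of_mem_segment (toMatrix_self x) (toMatrix_comm x) h0 hseg

theorem ae_toMatrix_zero_injective [NullSingletonClass γ] :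
    ∀ᵐ x ∂entryLaw γ, Function.Injective (toMatrix x 0) := by
  have := nullSingletonClass_map_coe γ
  have hne : ∀ i j, i < j → ∀ᵐ x ∂entryLaw γ, toMatrix x 0 i ≠ toMatrix x 0 j := by
    intro i j hij
    rcases i.eq_zero_or_pos with rfl | hi
    · simp only [toMatrix_self]
      exact ae_toMatrix_zero_of_ae γ (P := (0 ≠ ·))
        (measurableSet_eq_fun measurable_const measurable_id).compl
        ((Measure.ae_ne _ 0).mono fun _ => Ne.symm) hij
    · obtain ⟨t, ht⟩ := exists_entryIndex_eq_add_one 0 (show 1 < j by omega)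
      have hle : entryIndex 0 i ≤ t :=
        Nat.le_of_lt_succ ((entryIndex_lt_entryIndex_zero hi hij).trans_eq ht)
      have h := ae_entryLaw_of_ae_entryKernel γ (P := fun p => p.1 0 i ≠ p.2) (hi.trans hij) ht
        (measurableSet_eq_fun (f := fun p : (ℕ → ℕ → ℝ) × ℝ => p.1 0 i) (by fun_prop)
          measurable_snd).compl
        fun q => (Measure.ae_ne (γ.map ((↑) : ℝ≥0 → ℝ)) (q 0 i)).mono fun _ => Ne.symm
      filter_upwards [h] with x hx
      rwa [fragment_frestrictLe x hi hle] at hx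
  filter_upwards [ae_all_iff.2 fun i => ae_all_iff.2 fun j => ae_all_iff.2 (hne i j)] with x hx
  exact Function.Injective.of_lt_imp_ne fun i j => hx i j

end EntryLaw

/-! ### Approximation of a vector by the columns -/

/-- The filtration generated by the entries in the order in which they are chosen. -/
abbrev entryFiltration : Filtration ℕ (MeasurableSpace.pi : MeasurableSpace (ℕ → ℝ)) :=
  Filtration.piLE (X := fun _ => ℝ)

theorem measurable_eval_entryFiltration {t u : ℕ} (hu : u ≤ t) :
    Measurable[entryFiltration t] fun x : ℕ → ℝ => x u := by
  rw [entryFiltration, Filtration.piLE_eq_comap_frestrictLe]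
  exact (measurable_pi_apply (⟨u, Finset.mem_Iic.2 hu⟩ : Finset.Iic t)).comp
    (comap_measurable (Preorder.frestrictLe (π := fun _ => ℝ) t))

theorem measurable_toMatrix_of_lt {t i j : ℕ} (hij : i < j) (ht : entryIndex i j ≤ t) :
    Measurable[entryFiltration t] fun x : ℕ → ℝ => toMatrix x i j := by
  simp only [toMatrix_of_lt _ hij]
  exact measurable_eval_entryFiltration ht

theorem measurable_toMatrix_apply {t i j m : ℕ} (hi : i < m) (hj : j < m)
    (ht : entryIndex 0 m ≤ t + 1) :
    Measurable[entryFiltration t] fun x : ℕ → ℝ => toMatrix x i j := by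
  have hle : ∀ {i j}, i < j → j < m → entryIndex i j ≤ t := fun hij hj =>
    Nat.le_of_lt_succ ((entryIndex_lt_entryIndex_zero hij hj).trans_le ht)
  rcases lt_trichotomy i j with hij | rfl | hij
  · exact measurable_toMatrix_of_lt hij (hle hij hj)
  · simp only [toMatrix_self]
    exact measurable_const
  · simp only [toMatrix_comm _ i j]
    exact measurable_toMatrix_of_lt hij (hle hij hi)

theorem measurableSet_preimage_columnNear {α : Type*} [MeasurableSpace α] {f : α → ℕ → ℕ → ℝ}
    {n m : ℕ} (b : ℕ → ℝ) (η : ℝ) (hf : ∀ i < n, Measurable fun x => f x i m) :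
    MeasurableSet (f ⁻¹' columnNear n m b η) := by
  simp only [columnNear, ofPred_forall, preimage_iInter, preimage_ofPred_eq]
  exact .iInter fun i => .iInter fun hi =>
    measurableSet_le ((hf i hi).sub_const _).abs measurable_const

theorem measurableSet_preimage_nearAdmissible {α : Type*} [MeasurableSpace α]
    {f : α → ℕ → ℕ → ℝ} {n : ℕ} (b : ℕ → ℝ) (η : ℝ)
    (hf : ∀ i < n, ∀ j < n, Measurable fun x => f x i j) :
    MeasurableSet (f ⁻¹' nearAdmissible n b η) := by
  simp only [nearAdmissible, ofPred_forall, preimage_iInter, preimage_ofPred_eq]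
  exact .iInter fun i => .iInter fun hi => .iInter fun j => .iInter fun hj =>
    (measurableSet_le measurable_const ((hf i hi j hj).add_const _)).inter
      (measurableSet_le (hf i hi j hj) measurable_const)

theorem measurableSet_columnNear (n m : ℕ) (b : ℕ → ℝ) (η : ℝ) :
    MeasurableSet (columnNear n m b η) :=
  measurableSet_preimage_columnNear (f := id) b η fun _ _ => by simp only [id]; fun_prop

theorem measurableSet_nearAdmissible (n : ℕ) (b : ℕ → ℝ) (η : ℝ) :
    MeasurableSet (nearAdmissible n b η) :=
  measurableSet_preimage_nearAdmissible (f := id) b η fun _ _ _ _ => by simp only [id]; fun_prop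

section ColumnBound

variable (γ : Measure ℝ≥0) {b : ℕ → ℝ} {η : ℝ}

/-- A lower bound for the conditional probability that the `i`-th entry of a column approximates
`b i` when the preceding entries approximate the preceding values. -/
def columnBound (b : ℕ → ℝ) (η : ℝ) : ℕ → ℝ≥0∞
  | 0 => γ.map ((↑) : ℝ≥0 → ℝ) (Metric.closedBall (b 0) η)
  | k + 1 => ENNReal.ofReal (η / (η + (2 * b 0 + b (k + 1) + 3 * η)))

theorem columnBound_pos [γ.IsOpenPosMeasure] (hη : 0 < η) (hb : ∀ i, 0 ≤ b i) (k : ℕ) :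
    0 < columnBound γ b η k := by
  rcases k with _ | k
  · rw [columnBound, Measure.map_apply (by fun_prop) measurableSet_closedBall]
    have hball : (((↑) : ℝ≥0 → ℝ) ⁻¹' Metric.ball (b 0) η).Nonempty :=
      ⟨⟨b 0, hb 0⟩, Metric.mem_ball_self hη⟩
    exact ((Metric.isOpen_ball.preimage NNReal.continuous_coe).measure_pos γ hball).trans_le
      (measure_mono (preimage_mono Metric.ball_subset_closedBall))
  · have := hb 0
    have := hb (k + 1)
    rw [columnBound, ENNReal.ofReal_pos]
    positivity

theorem columnBound_le_entryKernel {n m k : ℕ} {r : ℕ → ℕ → ℝ} (hη : 0 < η) (hr : r ∈ distCone)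
    (hb : r ∈ nearAdmissible n b η) (hk : k < n) (hm : r ∈ columnNear k m b η) :
    columnBound γ b η k ≤ entryKernel γ k m r (Metric.closedBall (b k) (tolerance η k)) := by
  rcases k with _ | k
  · simp only [columnBound, entryKernel, tolerance_zero, Kernel.const_apply, le_refl]
  · obtain ⟨c, hc, hcb⟩ := segment_inter_closedBall_nonempty hη.le hr hb hk hm
    have hsub : Metric.closedBall c η ⊆
        Metric.closedBall (b (k + 1)) (tolerance η (k + 1)) :=
      Metric.closedBall_subset_closedBall' (by linarith [Metric.mem_closedBall.1 hcb])
    exact (le_unif_closedBall hc hη (upper_sub_lower_le hb hk hm)).trans (measure_mono hsub)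

variable [IsProbabilityMeasure γ]

theorem prod_mul_entryLaw_le {t n m : ℕ} (hnm : n ≤ m) (ht : entryIndex 0 m = t + 1)
    (hη : 0 < η) {A : Set (ℕ → ℝ)} (hA : MeasurableSet[entryFiltration t] A)
    (hAb : A ⊆ toMatrix ⁻¹' nearAdmissible n b η) {k : ℕ} (hk : k ≤ n) :
    (∏ i ∈ Finset.range k, columnBound γ b η i) * entryLaw γ A ≤
      entryLaw γ (A ∩ toMatrix ⁻¹' columnNear k m b η) := by
  induction k with
  | zero => simp [columnNear]
  | succ k ih =>
    have hkm : k < m := by omega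
    have htk : entryIndex k m = t + k + 1 := by
      rw [entryIndex] at ht ⊢
      omega
    have hAk : MeasurableSet[entryFiltration (t + k)]
        (A ∩ toMatrix ⁻¹' columnNear k m b η) :=
      (entryFiltration.mono (Nat.le_add_right t k) _ hA).inter <|
        @measurableSet_preimage_columnNear _ (entryFiltration _) _ _ _ b η fun i hi =>
          measurable_toMatrix_of_lt (hi.trans hkm) <|
            Nat.le_of_lt_succ ((entryIndex_lt_of_lt_left hi m).trans_eq htk)
    calc (∏ i ∈ Finset.range (k + 1), columnBound γ b η i) * entryLaw γ A
        = columnBound γ b η k * ((∏ i ∈ Finset.range k, columnBound γ b η i) * entryLaw γ A) := by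
          rw [Finset.prod_range_succ]
          ring
      _ ≤ columnBound γ b η k * entryLaw γ (A ∩ toMatrix ⁻¹' columnNear k m b η) := by
          gcongr
          exact ih (by omega)
      _ ≤ entryLaw γ (A ∩ toMatrix ⁻¹' columnNear k m b η ∩
            {x | x (t + k + 1) ∈ Metric.closedBall (b k) (tolerance η k)}) := by
          refine mul_trajMeasure_le _ _ hAk measurableSet_closedBall ?_
          filter_upwards [ae_toMatrix_mem_distCone γ] with x hx hxA
          rw [stepKernel_frestrictLe γ x hkm htk]
          exact columnBound_le_entryKernel γ hη hx (hAb hxA.1) hk hxA.2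
      _ = entryLaw γ (A ∩ toMatrix ⁻¹' columnNear (k + 1) m b η) := by
          rw [columnNear_succ, preimage_inter, inter_assoc, preimage_ofPred_eq]
          simp only [toMatrix_of_lt _ hkm, htk]

theorem ae_exists_columnNear [γ.IsOpenPosMeasure] (n : ℕ) (hη : 0 < η) (hb : ∀ i, 0 ≤ b i) :
    ∀ᵐ x ∂entryLaw γ, toMatrix x ∈ nearAdmissible n b η →
      ∃ m, toMatrix x ∈ columnNear n m b η := by
  set S := toMatrix ⁻¹' nearAdmissible n b η
  set E := fun l => toMatrix ⁻¹' columnNear n (n + 2 + l) b η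
  have hzero : entryLaw γ (S \ ⋃ l, E l) = 0 := by
    refine measure_sdiff_iUnion_eq_zero
      (measurable_toMatrix (measurableSet_nearAdmissible n b η))
      (fun l => measurable_toMatrix (measurableSet_columnNear n _ b η))
      (Finset.prod_ne_zero_iff.2 fun i (_ : i ∈ Finset.range n) =>
        (columnBound_pos γ hη hb i).ne') fun N => ?_
    obtain ⟨t, ht⟩ := exists_entryIndex_eq_add_one 0 (show 1 < n + 2 + N by omega)
    have hentry : ∀ {i j}, i < n + 2 + N → j < n + 2 + N →
        Measurable[entryFiltration t] fun x : ℕ → ℝ => toMatrix x i j := fun hi hj =>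
      measurable_toMatrix_apply hi hj ht.le
    have hS : MeasurableSet[entryFiltration t] S :=
      @measurableSet_preimage_nearAdmissible _ (entryFiltration t) _ _ b η fun i hi j hj =>
        hentry (by omega) (by omega)
    have hE : ∀ l < N, MeasurableSet[entryFiltration t] (E l) := fun l hl =>
      @measurableSet_preimage_columnNear _ (entryFiltration t) _ _ _ b η fun i hi =>
        hentry (by omega) (by omega)
    exact prod_mul_entryLaw_le γ (by omega) ht hη
      (hS.diff (.iUnion fun l => .iUnion fun hl => hE l hl)) sdiff_subset le_rfl
  refine measure_mono_null (fun x hx => ?_) hzero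
  obtain ⟨hadm, hnone⟩ := Classical.not_imp.1 hx
  exact ⟨hadm, fun hx => hnone ((mem_iUnion.1 hx).imp' _ fun _ => id)⟩

end ColumnBound

/-! ### The measure on the cone -/

section Cone

variable (γ : Measure ℝ≥0) [IsProbabilityMeasure γ]

theorem isProbabilityMeasure_nu : IsProbabilityMeasure (nu γ) := by
  have := Measure.isProbabilityMeasure_map (μ := entryLaw γ) measurable_toMatrix.aemeasurable
  refine (MeasurableEmbedding.subtype_coe measurableSet_distCone).isProbabilityMeasure_comap ?_
  rw [Subtype.range_coe]
  exact (ae_map_iff measurable_toMatrix.aemeasurable measurableSet_distCone).2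
    (ae_toMatrix_mem_distCone γ)

theorem ae_nu_of_ae_entryLaw {P : (ℕ → ℕ → ℝ) → Prop} (hP : MeasurableSet {q | P q})
    (h : ∀ᵐ x ∂entryLaw γ, P (toMatrix x)) : ∀ᵐ r ∂nu γ, P r.1 := by
  rw [← ae_map_iff measurable_toMatrix.aemeasurable hP] at h
  exact (MeasurableEmbedding.subtype_coe measurableSet_distCone).ae_map_iff.1 <| by
    rw [nu, (MeasurableEmbedding.subtype_coe measurableSet_distCone).map_comap]
    exact ae_restrict_of_ae h

theorem isProper_of_injective {r : distCone} (hr : Function.Injective (r.1 0)) : IsProper r := by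
  intro i j hij h0
  obtain ⟨-, -, hcomm, htri⟩ := r.2
  exact hij (hr (by linarith [htri 0 i j, htri 0 j i, hcomm i j]))

theorem ae_nu_isProper [NullSingletonClass γ] : ∀ᵐ r ∂nu γ, IsProper r := by
  have hmeas : MeasurableSet {q : ℕ → ℕ → ℝ | Function.Injective (q 0)} := by
    simp only [Function.Injective, ofPred_forall]
    exact .iInter fun i => .iInter fun j =>
      (measurableSet_eq_fun (by fun_prop) (by fun_prop)).imp (.const _)
  filter_upwards [ae_nu_of_ae_entryLaw γ hmeas (ae_toMatrix_zero_injective γ)] with r hr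
  exact isProper_of_injective hr

theorem ae_nu_isUniversal [γ.IsOpenPosMeasure] : ∀ᵐ r ∂nu γ, IsUniversal r := by
  obtain ⟨S, hScount, hS⟩ := TopologicalSpace.exists_countable_dense (ℕ → ℝ≥0)
  have h : ∀ b ∈ S, ∀ᵐ r ∂nu γ, ∀ n N : ℕ, r.1 ∈ nearAdmissible n (fun i => b i) (1 / (N + 1)) →
      ∃ m, r.1 ∈ columnNear n m (fun i => b i) (1 / (N + 1)) := by
    refine fun b _ => ae_all_iff.2 fun n => ae_all_iff.2 fun N => ae_nu_of_ae_entryLaw γ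
      (P := fun q => q ∈ nearAdmissible n _ _ → ∃ m, q ∈ columnNear n m _ _) ?_
      (ae_exists_columnNear γ n (by positivity) fun i => (b i).coe_nonneg)
    refine (measurableSet_nearAdmissible n _ _).imp ?_
    rw [ofPred_exists]
    exact .iUnion fun m => measurableSet_columnNear n m _ _
  filter_upwards [(ae_ball_iff hScount).2 h] with r hr
  exact isUniversal_of_nearAdmissible hS hr

end Cone

end RandomMetric

end

theorem theorem4 (γ : Measure ℝ≥0) [IsProbabilityMeasure γ] [NullSingletonClass γ]
    [Measure.IsOpenPosMeasure γ] :
    IsProbabilityMeasure (RandomMetric.nu γ) ∧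
    (∀ᵐ r ∂(RandomMetric.nu γ), RandomMetric.IsProper r ∧ RandomMetric.IsUniversal r) ∧
    (∀ᵐ r ∂(RandomMetric.nu γ), RandomMetric.IsUrysohn (RandomMetric.Completed r) ∧
      ∀ (U : Type*) [MetricSpace U], RandomMetric.IsUrysohn U →
        Nonempty (RandomMetric.Completed r ≃ᵢ U)) := by
  have huniv := RandomMetric.ae_nu_isUniversal γ
  refine ⟨RandomMetric.isProbabilityMeasure_nu γ, (RandomMetric.ae_nu_isProper γ).and huniv, ?_⟩
  filter_upwards [huniv] with r hr
  exact ⟨hr.isUrysohn, fun U _ hU => hr.isUrysohn.nonempty_isometryEquiv hU⟩
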